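/- Let $\alpha$ be an infinite set. Work in the language with a binary operation $+$, unary operations $-$ and $c_i$ ($i\in\alpha$), constants $d_{ij}$ ($i,j\in\alpha$), and countably many variables; write $x\cdot y=-(-x+-y)$ and $1=x+-x$. The cylindric axioms of dimension $\alpha$ are equations stating that $\langle A,+,-\rangle$ is a Boolean algebra, together with the equations $$c_ic_jx=c_jc_ix,\quad x+c_ix=c_ix,\quad c_ic_ix=c_ix,\quad c_i(x+y)=c_ix+c_iy,\quad c_i(-c_ix)=-c_ix,\quad d_{ii}=1,\quad d_{ij}=d_{ji}$$ for all $i,j\in\alpha$, the equations $c_j(d_{ij}\cdot d_{jk})=d_{ik}$ for all pairwise distinct $i,j,k\in\alpha$, and the equations $c_id_{ij}=1$ and $d_{ij}\cdot c_i(d_{ij}\cdot x)=d_{ij}\cdot x$ for all distinct $i,j\in\alpha$. A cylindric algebra of dimension $\alpha$ is an algebra in this language satisfying these axioms; it is locally finite dimensional if for every element $a$ the set $\{i\in\alpha : c_ia\neq a\}$ is finite. $\mathrm{Lf}_\alpha$ denotes the class of all locally finite dimensional cylindric algebras of dimension $\alpha$, and, for a class $K$ of algebras, $\mathrm{Eq}(K)$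 denotes the set of all equations valid in every member of $K$. A set $E$ of equations in this language is called inductive if 1. $E$ contains the cylindric axioms of dimension $\alpha$; 2. $E$ is semantically closed: an equation $e$ belongs to $E$ if and only if $e$ is valid in every algebra in which all equations of $E$ are valid; 3. for every equation $e=e(x_1,\dots,x_n)$ and every $i\in\alpha$ that does not occur as an index of an operation in $e$, if $e(c_ix_1,\dots,c_ix_n)\in E$, then $e(x_1,\dots,x_n)\in E$. **Theorem.** For every set $E$ of equations in this language, $E$ is inductive if and only if $E=\mathrm{Eq}(K)$ for some class $K\subseteq\mathrm{Lf}_\alpha$. In particular, a semantically closed set $E$ of equations containing the cylindric axioms satisfies condition 3 if and only if $E=\mathrm{Eq}(K)$ for some class $K\subseteq\mathrm{Lf}_\alpha$. -/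

import Mathlib

universe u

/-- Operation symbols of cylindric algebras of dimension `α`, sorted by arity:
Boolean join `+`, Boolean complement `-`, cylindrifications `c i`, diagonal constants `d i j`. -/
inductive CylFunc (α : Type u) : ℕ → Type u
  | diag (i j : α) : CylFunc α 0
  | compl : CylFunc α 1
  | cyl (i : α) : CylFunc α 1
  | join : CylFunc α 2

/-- The set of dimension indices occurring in an operation symbol. -/
def CylFunc.ind {α : Type u} : {n : ℕ} → CylFunc α n → Set α
  | _, .diag i j => {i, j}
  | _, .compl => ∅
  | _, .cyl i => {i}
  | _, .join => ∅

/-- The algebraic language of cylindric algebras of dimension `α` (no relation symbols). -/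
def cylLang (α : Type u) : FirstOrder.Language.{u, 0} :=
  ⟨CylFunc α, fun _ => Empty⟩

/-- Terms in the language of cylindric algebras, over the variables `x 0, x 1, x 2, …`. -/
abbrev CylTerm (α : Type u) : Type u := (cylLang α).Term ℕ

namespace CylTerm

variable {α : Type u}

/-- The variable `x n`. -/
def x (n : ℕ) : CylTerm α := FirstOrder.Language.Term.var n

/-- `s + t`. -/
def join (s t : CylTerm α) : CylTerm α :=
  FirstOrder.Language.Functions.apply₂ (L := cylLang α) CylFunc.join s t

/-- `-t`. -/
def compl (t : CylTerm α) : CylTerm α :=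
  FirstOrder.Language.Functions.apply₁ (L := cylLang α) CylFunc.compl t

/-- `c i t`. -/
def cyl (i : α) (t : CylTerm α) : CylTerm α :=
  FirstOrder.Language.Functions.apply₁ (L := cylLang α) (CylFunc.cyl i) t

/-- `d i j`. -/
def diag (i j : α) : CylTerm α :=
  FirstOrder.Language.Constants.term (L := cylLang α) (CylFunc.diag i j)

/-- The derived meet `s · t = -(-s + -t)`. -/
def meet (s t : CylTerm α) : CylTerm α := compl (join (compl s) (compl t))

/-- The derived unit `1`, written as `x 0 + -(x 0)`. -/
def one : CylTerm α := join (x 0) (compl (x 0))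

/-- The set of indices occurring in a term. -/
def ind : CylTerm α → Set α
  | .var _ => ∅
  | .func f ts => CylFunc.ind f ∪ ⋃ k, ind (ts k)

end CylTerm

/-- An equation `lhs = rhs` in the language of cylindric algebras of dimension `α`. -/
@[ext] structure CylEq (α : Type u) where
  /-- left-hand side -/
  lhs : CylTerm α
  /-- right-hand side -/
  rhs : CylTerm α

namespace CylEq

variable {α : Type u}

/-- The set of indices occurring in an equation. -/
def ind (e : CylEq α) : Set α := CylTerm.ind e.lhs ∪ CylTerm.ind e.rhs

/-- The equation `e(c i x₁, …, c i xₙ)`: every variable `x k` of `e` is replaced by `c i (x k)`. -/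
def cylSubst (i : α) (e : CylEq α) : CylEq α where
  lhs := e.lhs.subst fun k => CylTerm.cyl i (CylTerm.x k)
  rhs := e.rhs.subst fun k => CylTerm.cyl i (CylTerm.x k)

/-- `A ⊨ e`: the equation `e` holds in `A` under all evaluations of the variables. -/
def Valid (A : Type u) [(cylLang α).Structure A] (e : CylEq α) : Prop :=
  ∀ v : ℕ → A, e.lhs.realize v = e.rhs.realize v

end CylEq

/-- The algebras of the similarity type of cylindric algebras of dimension `α`. -/
abbrev CylTypeAlg (α : Type u) : Type (u + 1) := CategoryTheory.Bundled.{u} (cylLang α).Structure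

open CylTerm in
/-- The axioms of cylindric algebras of dimension `α`: axioms for Boolean algebras in terms of
`+` and `-` (with the derived meet), followed by the axioms for cylindrifications and diagonals. -/
inductive CylAxiom (α : Type u) : CylEq α → Prop
  | join_comm : CylAxiom α ⟨join (x 0) (x 1), join (x 1) (x 0)⟩
  | join_assoc : CylAxiom α
      ⟨join (join (x 0) (x 1)) (x 2), join (x 0) (join (x 1) (x 2))⟩
  | meet_comm : CylAxiom α ⟨meet (x 0) (x 1), meet (x 1) (x 0)⟩
  | meet_assoc : CylAxiom α
      ⟨meet (meet (x 0) (x 1)) (x 2), meet (x 0) (meet (x 1) (x 2))⟩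
  | join_meet_self : CylAxiom α ⟨join (x 0) (meet (x 0) (x 1)), x 0⟩
  | meet_join_self : CylAxiom α ⟨meet (x 0) (join (x 0) (x 1)), x 0⟩
  | meet_join_distrib : CylAxiom α
      ⟨meet (x 0) (join (x 1) (x 2)), join (meet (x 0) (x 1)) (meet (x 0) (x 2))⟩
  | join_meet_compl : CylAxiom α ⟨join (x 0) (meet (x 1) (compl (x 1))), x 0⟩
  | meet_join_compl : CylAxiom α ⟨meet (x 0) (join (x 1) (compl (x 1))), x 0⟩
  | cyl_comm (i j : α) : CylAxiom α ⟨cyl i (cyl j (x 0)), cyl j (cyl i (x 0))⟩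
  -- `x ≤ c i x`
  | le_cyl (i : α) : CylAxiom α ⟨join (x 0) (cyl i (x 0)), cyl i (x 0)⟩
  | cyl_cyl (i : α) : CylAxiom α ⟨cyl i (cyl i (x 0)), cyl i (x 0)⟩
  | cyl_join (i : α) : CylAxiom α
      ⟨cyl i (join (x 0) (x 1)), join (cyl i (x 0)) (cyl i (x 1))⟩
  | cyl_compl (i : α) : CylAxiom α ⟨cyl i (compl (cyl i (x 0))), compl (cyl i (x 0))⟩
  | diag_self (i : α) : CylAxiom α ⟨diag i i, one⟩
  | diag_symm (i j : α) : CylAxiom α ⟨diag i j, diag j i⟩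
  | diag_trans (i j k : α) (hij : i ≠ j) (hjk : j ≠ k) (hik : i ≠ k) : CylAxiom α
      ⟨cyl j (meet (diag i j) (diag j k)), diag i k⟩
  | cyl_diag (i j : α) (hij : i ≠ j) : CylAxiom α ⟨cyl i (diag i j), one⟩
  | diag_cyl (i j : α) (hij : i ≠ j) : CylAxiom α
      ⟨meet (diag i j) (cyl i (meet (diag i j) (x 0))), meet (diag i j) (x 0)⟩

/-- The set of all cylindric algebra axioms. -/
def cylAxioms (α : Type u) : Set (CylEq α) := {e | CylAxiom α e}

/-- `A` is a cylindric algebra of dimension `α`. -/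
def IsCylindric {α : Type u} (A : CylTypeAlg α) : Prop :=
  ∀ e ∈ cylAxioms α, e.Valid A

/-- `A` is a locally finite dimensional cylindric algebra: each element is a fixed point of
all but finitely many cylindrifications. -/
def IsLocallyFiniteDim {α : Type u} (A : CylTypeAlg α) : Prop :=
  IsCylindric A ∧
    ∀ a : A, {i : α | FirstOrder.Language.Structure.funMap (L := cylLang α) (CylFunc.cyl i) ![a] ≠ a}.Finite

/-- The class of locally finite dimensional cylindric algebras of dimension `α`. -/
def Lf (α : Type u) : Set (CylTypeAlg α) := {A | IsLocallyFiniteDim A}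

/-- The set of all equations valid in every member of the class `K`. -/
def eqTheory {α : Type u} (K : Set (CylTypeAlg α)) : Set (CylEq α) :=
  {e | ∀ A ∈ K, e.Valid A}

/-- `E ⊨ e`: the equation `e` is valid in every algebra in which all members of `E` are valid.
The terms over `α` live in the same universe `u` as the algebras, so that all `E`-free algebras
on countably many generators are among the algebras considered. -/
def Entails {α : Type u} (E : Set (CylEq α)) (e : CylEq α) : Prop :=
  ∀ A : CylTypeAlg α, (∀ f ∈ E, f.Valid A) → e.Valid A

/-- `E` is semantically closed. -/
def SemanticallyClosed {α : Type u} (E : Set (CylEq α)) : Prop :=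
  ∀ e : CylEq α, e ∈ E ↔ Entails E e

/-- `E` is an inductive set of equations: it contains the cylindric axioms, it is semantically
closed, and `e(c i x₁, …, c i xₙ) ∈ E` implies `e(x₁, …, xₙ) ∈ E` whenever the index `i` does
not occur in `e`. -/
structure IsInductiveSet {α : Type u} (E : Set (CylEq α)) : Prop where
  axioms_subset : cylAxioms α ⊆ E
  closed : SemanticallyClosed E
  inductive_rule : ∀ (e : CylEq α) (i : α), i ∉ e.ind → e.cylSubst i ∈ E → e ∈ E

open FirstOrder FirstOrder.Language

universe w

/-! Equational theories of locally finite algebras obey the inductive rule because a fresh index `j`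
exists. The operator `s i j` is a Boolean endomorphism commuting with every operation whose indices
avoid `i` and `j`, and its values are fixed by `c i`. If `e(c i x)` is valid, then `e` holds at `s i
j v`, so `s i j` identifies the two sides of `e` at `v`; when `c j` fixes both sides, `s j i` undoes
`s i j` (`s_s`). Only this direction needs `α` infinite.

Conversely, an inductive `E` is the theory of all its locally finite models. For an equation `e`,
identify two terms if `E` makes them equal under evaluations fixed by `c i` for all `i` in some
finite set `Γ` of indices not in `e`. The quotient `termModel` satisfies `E` and is locally finite.
If `e` is valid there, evaluation at the variables themselves gives one such `Γ` for `e`, and the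
inductive rule removes its members one at a time (`IsInductiveSet.mem_of_fixedEntails`). -/

/-- Cylindric algebras of dimension `α`, presented over Mathlib's Boolean algebras. -/
class CylindricAlgebra (α : outParam (Type w)) (B : Type u) extends BooleanAlgebra B where
  /-- cylindrification -/
  c : α → B → B
  /-- diagonal elements -/
  d : α → α → B
  c_comm (i j : α) (x : B) : c i (c j x) = c j (c i x)
  le_c (i : α) (x : B) : x ≤ c i x
  c_c (i : α) (x : B) : c i (c i x) = c i x
  c_sup (i : α) (x y : B) : c i (x ⊔ y) = c i x ⊔ c i y
  c_compl (i : α) (x : B) : c i (c i x)ᶜ = (c i x)ᶜ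
  d_self (i : α) : d i i = ⊤
  d_symm (i j : α) : d i j = d j i
  d_trans (i j k : α) : i ≠ j → j ≠ k → i ≠ k → c j (d i j ⊓ d j k) = d i k
  c_d (i j : α) : i ≠ j → c i (d i j) = ⊤
  d_c (i j : α) (x : B) : i ≠ j → d i j ⊓ c i (d i j ⊓ x) = d i j ⊓ x

/-! ### Arithmetic of cylindrifications and substitution operators. -/

namespace CylindricAlgebra

variable {α : Type w} {B : Type u} [CylindricAlgebra α B]

theorem c_mono (i : α) {x y : B} (h : x ≤ y) : c i x ≤ c i y := by
  rw [← sup_eq_right.2 h, c_sup]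
  exact le_sup_left

theorem c_top (i : α) : c i (⊤ : B) = ⊤ := top_le_iff.1 (le_c i ⊤)

theorem c_bot (i : α) : c i (⊥ : B) = ⊥ := by
  simpa [c_top] using c_compl i (⊤ : B)

theorem c_compl_of_fixed {i : α} {x : B} (h : c i x = x) : c i xᶜ = xᶜ := by
  simpa [h] using c_compl i x

theorem c_inf_c (i : α) (x y : B) : c i (x ⊓ c i y) = c i x ⊓ c i y := by
  apply le_antisymm
  · refine le_inf (c_mono i inf_le_left) ?_
    simpa [c_c] using c_mono i (inf_le_right : x ⊓ c i y ≤ c i y)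
  · have h : c i x = c i (x ⊓ c i y) ⊔ c i (x ⊓ (c i y)ᶜ) := by
      rw [← c_sup, ← inf_sup_left, sup_compl_eq_top, inf_top_eq]
    have h' : c i (x ⊓ (c i y)ᶜ) ≤ (c i y)ᶜ := by
      simpa [c_compl] using c_mono i (inf_le_right : x ⊓ (c i y)ᶜ ≤ (c i y)ᶜ)
    calc c i x ⊓ c i y
        ≤ (c i (x ⊓ c i y) ⊔ (c i y)ᶜ) ⊓ c i y := by
          rw [h]; exact inf_le_inf_right _ (sup_le_sup_left h' _)
      _ ≤ c i (x ⊓ c i y) := by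
          rw [inf_sup_right, compl_inf_eq_bot, sup_bot_eq]; exact inf_le_left

theorem c_inf_of_fixed {i : α} (x : B) {y : B} (h : c i y = y) : c i (x ⊓ y) = c i x ⊓ y := by
  simpa [h] using c_inf_c i x y

theorem c_d_of_ne {i j k : α} (hi : k ≠ i) (hj : k ≠ j) : c k (d i j : B) = d i j := by
  by_cases hij : i = j
  · rw [hij, d_self, c_top]
  · rw [← d_trans i k j hi.symm hj hij, c_c]

/-- The substitution operator `s i j x = c i (d i j · x)`. -/
def s (i j : α) (x : B) : B := c i (d i j ⊓ x)

theorem c_s (i j : α) (x : B) : c i (s i j x) = s i j x := c_c _ _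

theorem s_sup (i j : α) (x y : B) : s i j (x ⊔ y) = s i j x ⊔ s i j y := by
  rw [s, inf_sup_left, c_sup]; rfl

/-- Below `d i j` the axiom `d_c` recovers an element from its cylindrification, so disjoint
elements have disjoint images; the images join to `c i (d i j) = ⊤`. -/
theorem s_compl {i j : α} (hij : i ≠ j) (x : B) : s i j xᶜ = (s i j x)ᶜ := by
  symm
  rw [compl_eq_iff_isCompl]
  refine IsCompl.of_eq ?_ ?_
  · rw [s, s, ← c_inf_c, inf_assoc, inf_left_comm, d_c i j _ hij, inf_left_comm x,
      inf_compl_eq_bot, inf_bot_eq, c_bot]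
  · rw [← s_sup, sup_compl_eq_top, s, inf_top_eq, c_d i j hij]

theorem s_c {i j k : α} (hi : k ≠ i) (hj : k ≠ j) (x : B) : s i j (c k x) = c k (s i j x) := by
  rw [s, s, c_comm k i, inf_comm _ x, c_inf_of_fixed x (c_d_of_ne hi hj), inf_comm]

theorem s_d {i j k l : α} (hij : i ≠ j) (hk : i ≠ k) (hl : i ≠ l) :
    s i j (d k l : B) = d k l := by
  rw [s, c_inf_of_fixed _ (c_d_of_ne hk hl), c_d i j hij, top_inf_eq]

/-- By `d_c` the inner cylindrification disappears below the diagonal; then `x`, being fixed, comes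
out of `c j`, leaving `c j (d j i) = ⊤`. -/
theorem s_s {i j : α} (hij : i ≠ j) {x : B} (h : c j x = x) : s j i (s i j x) = x := by
  rw [s, s, d_symm j i, d_c i j x hij, c_inf_of_fixed _ h, d_symm i j, c_d j i hij.symm,
    top_inf_eq]

end CylindricAlgebra

/-! ### Terms, their indices and their values. -/

section Interpretation

variable {α : Type u}

/-- The join of an algebra in the language of cylindric algebras. -/
def opJoin (A : Type u) [(cylLang α).Structure A] (a b : A) : A :=
  Structure.funMap (L := cylLang α) CylFunc.join ![a, b]

/-- The complement of an algebra in the language of cylindric algebras. -/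
def opCompl (A : Type u) [(cylLang α).Structure A] (a : A) : A :=
  Structure.funMap (L := cylLang α) CylFunc.compl ![a]

/-- The cylindrifications of an algebra in the language of cylindric algebras. -/
def opCyl (A : Type u) [(cylLang α).Structure A] (i : α) (a : A) : A :=
  Structure.funMap (L := cylLang α) (CylFunc.cyl i) ![a]

/-- The diagonal elements of an algebra in the language of cylindric algebras. -/
def opDiag (A : Type u) [(cylLang α).Structure A] (i j : α) : A :=
  Structure.funMap (L := cylLang α) (CylFunc.diag i j) ![]

variable {A : Type u} [(cylLang α).Structure A] (v : ℕ → A)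

@[simp] theorem realize_x (n : ℕ) : (CylTerm.x n : CylTerm α).realize v = v n := rfl

@[simp] theorem realize_join (s t : CylTerm α) :
    (CylTerm.join s t).realize v = opJoin (α := α) A (s.realize v) (t.realize v) :=
  Term.realize_functions_apply₂

@[simp] theorem realize_compl (t : CylTerm α) :
    (CylTerm.compl t).realize v = opCompl (α := α) A (t.realize v) :=
  Term.realize_functions_apply₁

@[simp] theorem realize_cyl (i : α) (t : CylTerm α) :
    (CylTerm.cyl i t).realize v = opCyl A i (t.realize v) :=
  Term.realize_functions_apply₁

@[simp] theorem realize_diag (i j : α) :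
    (CylTerm.diag i j : CylTerm α).realize v = opDiag A i j :=
  Term.realize_constants

theorem realize_meet (s t : CylTerm α) :
    (CylTerm.meet s t).realize v = opCompl (α := α) A
      (opJoin (α := α) A (opCompl (α := α) A (s.realize v))
        (opCompl (α := α) A (t.realize v))) := by
  simp [CylTerm.meet]

theorem realize_one :
    (CylTerm.one : CylTerm α).realize v =
      opJoin (α := α) A (v 0) (opCompl (α := α) A (v 0)) := by
  simp [CylTerm.one]

/-- Induction on terms along the operations of cylindric algebras. -/
theorem CylTerm.induction {P : CylTerm α → Prop} (hx : ∀ n, P (CylTerm.x n))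
    (hjoin : ∀ s t, P s → P t → P (CylTerm.join s t)) (hcompl : ∀ t, P t → P (CylTerm.compl t))
    (hcyl : ∀ i t, P t → P (CylTerm.cyl i t)) (hdiag : ∀ i j, P (CylTerm.diag i j))
    (t : CylTerm α) : P t := by
  induction t with
  | var n => exact hx n
  | func f ts ih =>
    cases f with
    | diag i j =>
      convert hdiag i j
      exact congrArg _ (Subsingleton.elim _ _)
    | compl =>
      convert hcompl _ (ih 0)
      refine congrArg _ (funext fun k => ?_)
      fin_cases k; rfl
    | cyl i =>
      convert hcyl i _ (ih 0)
      refine congrArg _ (funext fun k => ?_)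
      fin_cases k; rfl
    | join =>
      convert hjoin _ _ (ih 0) (ih 1)
      refine congrArg _ (funext fun k => ?_)
      fin_cases k <;> rfl

@[simp] theorem CylTerm.ind_x (n : ℕ) : CylTerm.ind (CylTerm.x n : CylTerm α) = ∅ := by
  simp [CylTerm.x, CylTerm.ind]

@[simp] theorem CylTerm.ind_join (s t : CylTerm α) :
    CylTerm.ind (CylTerm.join s t) = CylTerm.ind s ∪ CylTerm.ind t := by
  ext a
  simp [CylTerm.join, CylTerm.ind, CylFunc.ind, Functions.apply₂, Fin.exists_fin_two]

@[simp] theorem CylTerm.ind_compl (t : CylTerm α) :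
    CylTerm.ind (CylTerm.compl t) = CylTerm.ind t := by
  ext a
  simp [CylTerm.compl, CylTerm.ind, CylFunc.ind, Functions.apply₁]

@[simp] theorem CylTerm.ind_cyl (i : α) (t : CylTerm α) :
    CylTerm.ind (CylTerm.cyl i t) = insert i (CylTerm.ind t) := by
  ext a
  simp [CylTerm.cyl, CylTerm.ind, CylFunc.ind, Functions.apply₁]

@[simp] theorem CylTerm.ind_diag (i j : α) :
    CylTerm.ind (CylTerm.diag i j : CylTerm α) = {i, j} := by
  ext a
  simp [CylTerm.diag, CylTerm.ind, CylFunc.ind, Constants.term]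

theorem CylTerm.finite_ind (t : CylTerm α) : (CylTerm.ind t).Finite := by
  induction t using CylTerm.induction <;> simp_all

theorem CylEq.finite_ind (e : CylEq α) : e.ind.Finite :=
  (CylTerm.finite_ind _).union (CylTerm.finite_ind _)

theorem CylTerm.ind_subst_cyl (i : α) (t : CylTerm α) :
    CylTerm.ind (t.subst fun k => CylTerm.cyl i (CylTerm.x k)) ⊆ insert i (CylTerm.ind t) := by
  induction t with
  | var n => simp [Term.subst]
  | func f ts ih =>
    simp only [Term.subst, CylTerm.ind]
    rintro a (ha | ha)
    · exact Or.inr (Or.inl ha)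
    · obtain ⟨k, hk⟩ := Set.mem_iUnion.1 ha
      rcases ih k hk with h | h
      · exact Or.inl h
      · exact Or.inr (Or.inr (Set.mem_iUnion.2 ⟨k, h⟩))

theorem CylEq.ind_cylSubst (i : α) (e : CylEq α) : (e.cylSubst i).ind ⊆ insert i e.ind := by
  rintro a (ha | ha)
  · exact (CylTerm.ind_subst_cyl i _ ha).imp id Or.inl
  · exact (CylTerm.ind_subst_cyl i _ ha).imp id Or.inr

theorem CylEq.valid_cylSubst_iff (i : α) (e : CylEq α) (v : ℕ → A) :
    (e.cylSubst i).lhs.realize v = (e.cylSubst i).rhs.realize v ↔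
      e.lhs.realize (fun k => opCyl A i (v k)) = e.rhs.realize (fun k => opCyl A i (v k)) := by
  simp [CylEq.cylSubst, Term.realize_subst]

end Interpretation

/-! ### Models of the axioms, and soundness of the inductive rule. -/

section OfIsCylindric

variable {α : Type u}

open CylAxiom in
/-- A model of the cylindric axioms as a `CylindricAlgebra`; the element `o` only serves to name
the bounds. -/
abbrev IsCylindric.toCylindricAlgebra {A : CylTypeAlg α} (h : IsCylindric A) (o : A) :
    CylindricAlgebra α A :=
  letI : Max A := ⟨opJoin (α := α) A⟩
  letI : Min A := ⟨fun a b => opCompl (α := α) A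
    (opJoin (α := α) A (opCompl (α := α) A a) (opCompl (α := α) A b))⟩
  letI lat : Lattice A := Lattice.mk'
    (fun a b => by
      have e := h _ join_comm (fun n => if n = 0 then a else b)
      simp at e
      exact e)
    (fun a b c => by
      have e := h _ join_assoc (fun n => if n = 0 then a else if n = 1 then b else c)
      simp at e
      exact e)
    (fun a b => by
      have e := h _ meet_comm (fun n => if n = 0 then a else b)
      simp [realize_meet] at e
      exact e)
    (fun a b c => by
      have e := h _ meet_assoc (fun n => if n = 0 then a else if n = 1 then b else c)
      simp [realize_meet] at e
      exact e)
    (fun a b => by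
      have e := h _ join_meet_self (fun n => if n = 0 then a else b)
      simp [realize_meet] at e
      exact e)
    (fun a b => by
      have e := h _ meet_join_self (fun n => if n = 0 then a else b)
      simp [realize_meet] at e
      exact e)
  have sup_inf_compl (a b : A) : a ⊔ (b ⊓ opCompl (α := α) A b) = a := by
    have e := h _ join_meet_compl (fun n => if n = 0 then a else b)
    simp [realize_meet] at e
    exact e
  have inf_sup_compl (a b : A) : a ⊓ (b ⊔ opCompl (α := α) A b) = a := by
    have e := h _ meet_join_compl (fun n => if n = 0 then a else b)
    simp [realize_meet] at e
    exact e
  letI dist : DistribLattice A := DistribLattice.ofInfSupLe fun a b c => le_of_eq (by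
    have e := h _ meet_join_distrib (fun n => if n = 0 then a else if n = 1 then b else c)
    simp [realize_meet] at e
    exact e)
  -- Meeting with any `b + -b` changes nothing, so all these elements coincide and the bounds do not
  -- depend on `o`.
  have eq_top (a : A) : o ⊔ opCompl (α := α) A o = a ⊔ opCompl (α := α) A a :=
    le_antisymm (inf_eq_left.1 (inf_sup_compl _ _)) (inf_eq_left.1 (inf_sup_compl _ _))
  letI ba : BooleanAlgebra A :=
    { dist with
      compl := opCompl (α := α) A
      top := o ⊔ opCompl (α := α) A o
      bot := o ⊓ opCompl (α := α) A o
      inf_compl_le_bot := fun a => sup_eq_right.1 (by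
        rw [sup_comm]; exact sup_inf_compl _ _)
      top_le_sup_compl := fun a => (eq_top a).le
      le_top := fun a => inf_eq_left.1 (inf_sup_compl _ _)
      bot_le := fun a => sup_eq_left.1 (sup_inf_compl _ _) }
  { ba with
    c := opCyl A
    d := opDiag A
    c_comm := fun i j a => by
      have e := h _ (cyl_comm i j) (fun _ => a)
      simp at e
      exact e
    le_c := fun i a => sup_eq_right.1 (by
      have e := h _ (le_cyl i) (fun _ => a)
      simp at e
      exact e)
    c_c := fun i a => by
      have e := h _ (cyl_cyl i) (fun _ => a)
      simp at e
      exact e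
    c_sup := fun i a b => by
      have e := h _ (cyl_join i) (fun n => if n = 0 then a else b)
      simp at e
      exact e
    c_compl := fun i a => by
      have e := h _ (cyl_compl i) (fun _ => a)
      simp at e
      exact e
    d_self := fun i => by
      have e := h _ (diag_self i) (fun _ => o)
      simp [realize_one] at e
      exact e
    d_symm := fun i j => by
      have e := h _ (diag_symm i j) (fun _ => o)
      simp at e
      exact e
    d_trans := fun i j k hij hjk hik => by
      have e := h _ (diag_trans i j k hij hjk hik) (fun _ => o)
      simp [realize_meet] at e
      exact e
    c_d := fun i j hij => by
      have e := h _ (cyl_diag i j hij) (fun _ => o)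
      simp [realize_one] at e
      exact e
    d_c := fun i j a hij => by
      have e := h _ (diag_cyl i j hij) (fun _ => a)
      simp [realize_meet] at e
      exact e }

open CylindricAlgebra

/-- A cylindrification that fixes the values of the variables fixes the values of all terms in
which its index does not occur. -/
theorem IsCylindric.opCyl_realize {A : CylTypeAlg α} (h : IsCylindric A) {i : α} {v : ℕ → A}
    (hv : ∀ k, opCyl A i (v k) = v k) (t : CylTerm α) (hi : i ∉ CylTerm.ind t) :
    opCyl A i (t.realize v) = t.realize v := by
  let := h.toCylindricAlgebra (v 0)
  induction t using CylTerm.induction with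
  | hx n => exact hv n
  | hjoin s t hs ht =>
    simp only [CylTerm.ind_join, Set.mem_union, not_or] at hi
    rw [realize_join]
    refine (c_sup (B := A) i _ _).trans ?_
    exact congrArg₂ (opJoin (α := α) A) (hs hi.1) (ht hi.2)
  | hcompl t ht =>
    rw [realize_compl]
    exact c_compl_of_fixed (B := A) (ht (by simpa using hi))
  | hcyl j t ht =>
    simp only [CylTerm.ind_cyl, Set.mem_insert_iff, not_or] at hi
    rw [realize_cyl]
    exact (c_comm (B := A) i j _).trans (congrArg (opCyl A j) (ht hi.2))
  | hdiag j k =>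
    simp only [CylTerm.ind_diag, Set.mem_insert_iff, Set.mem_singleton_iff, not_or] at hi
    rw [realize_diag]
    exact c_d_of_ne (B := A) hi.1 hi.2

/-- With both indices absent from `t`, `s i j` acts as an endomorphism for every operation occurring
in `t`. -/
theorem IsCylindric.realize_s {A : CylTypeAlg α} (h : IsCylindric A) {i j : α} (hij : i ≠ j)
    (v : ℕ → A) (t : CylTerm α) (hi : i ∉ CylTerm.ind t) (hj : j ∉ CylTerm.ind t) :
    let := h.toCylindricAlgebra (v 0)
    t.realize (fun k => s i j (v k)) = s i j (t.realize v) := by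
  let := h.toCylindricAlgebra (v 0)
  change t.realize (fun k => s i j (v k)) = s i j (t.realize v)
  induction t using CylTerm.induction with
  | hx n => rfl
  | hjoin t t' ht ht' =>
    simp only [CylTerm.ind_join, Set.mem_union, not_or] at hi hj
    rw [realize_join, realize_join, ht hi.1 hj.1, ht' hi.2 hj.2]
    exact (s_sup (B := A) i j _ _).symm
  | hcompl t ht =>
    rw [realize_compl, realize_compl, ht (by simpa using hi) (by simpa using hj)]
    exact (s_compl (B := A) hij _).symm
  | hcyl k t ht =>
    simp only [CylTerm.ind_cyl, Set.mem_insert_iff, not_or] at hi hj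
    rw [realize_cyl, realize_cyl, ht hi.2 hj.2]
    exact (s_c (B := A) (Ne.symm hi.1) (Ne.symm hj.1) _).symm
  | hdiag k l =>
    simp only [CylTerm.ind_diag, Set.mem_insert_iff, Set.mem_singleton_iff, not_or] at hi hj
    rw [realize_diag, realize_diag]
    exact (s_d (B := A) hij hi.1 hi.2).symm

/-- Locally finite dimensional algebras of infinite dimension obey the inductive rule. -/
theorem IsLocallyFiniteDim.valid_of_valid_cylSubst [Infinite α] {A : CylTypeAlg α}
    (h : IsLocallyFiniteDim A) {e : CylEq α} {i : α} (hi : i ∉ e.ind)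
    (he : (e.cylSubst i).Valid A) : e.Valid A := by
  intro v
  -- Only the values of the two sides need to be fixed by `c j`, not the values of the variables.
  obtain ⟨j, hj⟩ := ((((h.2 (e.lhs.realize v)).union (h.2 (e.rhs.realize v))).union
    e.finite_ind).union (Set.finite_singleton i)).exists_notMem
  simp only [Set.mem_union, Set.mem_ofPred_eq, Set.mem_singleton_iff, not_or, not_not] at hj
  obtain ⟨⟨⟨hl, hr⟩, hje⟩, hji⟩ := hj
  have hij : i ≠ j := Ne.symm hji
  simp only [CylEq.ind, Set.mem_union, not_or] at hi hje
  let := h.1.toCylindricAlgebra (v 0)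
  have key := (CylEq.valid_cylSubst_iff i e _).1 (he fun k => s i j (v k))
  have fixed : (fun k => opCyl A i (s i j (v k))) = fun k => s i j (v k) :=
    funext fun k => c_s (B := A) i j _
  rw [fixed, h.1.realize_s hij v _ hi.1 hje.1, h.1.realize_s hij v _ hi.2 hje.2] at key
  calc e.lhs.realize v = s j i (s i j (e.lhs.realize v)) := (s_s (B := A) hij hl).symm
    _ = s j i (s i j (e.rhs.realize v)) := congrArg _ key
    _ = e.rhs.realize v := s_s (B := A) hij hr

theorem isInductiveSet_eqTheory [Infinite α] {K : Set (CylTypeAlg α)} (hK : K ⊆ Lf α) :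
    IsInductiveSet (eqTheory K) where
  axioms_subset e he _ hA := (hK hA).1 e he
  closed e := ⟨fun he _ hA => hA e he, fun he A hA => he A fun _ hf => hf A hA⟩
  inductive_rule _ _ hi he _ hA := (hK hA).valid_of_valid_cylSubst hi (he _ hA)

end OfIsCylindric

/-! ### Completeness via a locally finite term model. -/

section TermModel

variable {α : Type u}

/-- `e` holds in every model of `E` under all evaluations whose values are fixed by the
cylindrifications with index in `Γ`. -/
def FixedEntails (E : Set (CylEq α)) (Γ : Set α) (e : CylEq α) : Prop :=
  ∀ A : CylTypeAlg α, (∀ f ∈ E, f.Valid A) → ∀ v : ℕ → A,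
    (∀ i ∈ Γ, ∀ k, opCyl A i (v k) = v k) → e.lhs.realize v = e.rhs.realize v

theorem FixedEntails.mono {E : Set (CylEq α)} {Γ Δ : Set α} (h : Γ ⊆ Δ) {e : CylEq α}
    (he : FixedEntails E Γ e) : FixedEntails E Δ e :=
  fun A hA v hv => he A hA v fun i hi => hv i (h hi)

theorem IsInductiveSet.mem_of_fixedEntails {E : Set (CylEq α)} (hE : IsInductiveSet E)
    {Γ : Set α} (hΓ : Γ.Finite) {e : CylEq α} (hd : Disjoint Γ e.ind)
    (he : FixedEntails E Γ e) : e ∈ E := by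
  induction Γ, hΓ using Set.Finite.induction_on generalizing e with
  | empty => exact (hE.closed e).2 fun A hA v => he A hA v (by simp)
  | @insert i Γ hi _ ih =>
    rw [Set.disjoint_insert_left] at hd
    -- The tuple `c i v` is fixed by `c i`, and by `c j` for `j ∈ Γ` since cylindrifications
    -- commute. The substitution adds at most the index `i`, which is not in `Γ`, so disjointness
    -- survives.
    refine hE.inductive_rule e i hd.1 (ih ?_ ?_)
    · refine Set.disjoint_of_subset_right (CylEq.ind_cylSubst i e) ?_
      exact Set.disjoint_insert_right.2 ⟨hi, hd.2⟩
    · intro A hA v hv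
      have hcyl : IsCylindric A := fun f hf => hA f (hE.axioms_subset hf)
      let := hcyl.toCylindricAlgebra (v 0)
      refine (CylEq.valid_cylSubst_iff i e v).2 (he A hA _ ?_)
      rintro j (rfl | hj) k
      · exact CylindricAlgebra.c_c (B := A) j _
      · exact (CylindricAlgebra.c_comm (B := A) j i _).trans (congrArg (opCyl A i) (hv j hj k))

/-- Terms are identified if they are provably equal from `E` once the variables are assumed to be
fixed by finitely many cylindrifications with index outside `S`. -/
def fixedSetoid (E : Set (CylEq α)) (S : Set α) : Setoid (CylTerm α) where
  r s t := ∃ Γ : Set α, Γ.Finite ∧ Disjoint Γ S ∧ FixedEntails E Γ ⟨s, t⟩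
  iseqv :=
    { refl := fun _ => ⟨∅, Set.finite_empty, Set.empty_disjoint _, fun _ _ _ _ => rfl⟩
      symm := fun ⟨Γ, hf, hd, h⟩ => ⟨Γ, hf, hd, fun A hA v hv => (h A hA v hv).symm⟩
      trans := fun ⟨Γ, hf, hd, h⟩ ⟨Δ, hf', hd', h'⟩ =>
        ⟨Γ ∪ Δ, hf.union hf', Set.disjoint_union_left.2 ⟨hd, hd'⟩, fun A hA v hv =>
          (h.mono Set.subset_union_left A hA v hv).trans
            (h'.mono Set.subset_union_right A hA v hv)⟩ }

/-- The term algebra, compatible with `fixedSetoid E S`. -/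
instance fixedPrestructure (E : Set (CylEq α)) (S : Set α) :
    (cylLang α).Prestructure (fixedSetoid E S) where
  toStructure :=
    { funMap := fun f ts => Term.func f ts
      RelMap := fun r _ => r.elim }
  fun_equiv {_ f} ts ts' h := by
    have h' (k) : ∃ Γ : Set α, Γ.Finite ∧ Disjoint Γ S ∧ FixedEntails E Γ ⟨ts k, ts' k⟩ := h k
    choose Γ hf hd hΓ using h'
    -- Operations are finitary, so the union of the sets for the arguments is still finite.
    refine ⟨⋃ k, Γ k, Set.finite_iUnion hf, Set.disjoint_iUnion_left.2 hd, fun A hA v hv => ?_⟩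
    refine congrArg (Structure.funMap f) (funext fun k => ?_)
    exact (hΓ k).mono (Set.subset_iUnion _ k) A hA v hv
  rel_equiv {_ r} := r.elim

/-- The quotient of the term algebra by `fixedSetoid E S`. -/
def termModel (E : Set (CylEq α)) (S : Set α) : CylTypeAlg α :=
  ⟨Quotient (fixedSetoid E S), inferInstance⟩

theorem realize_termModel (E : Set (CylEq α)) (S : Set α) (t : CylTerm α) (σ : ℕ → CylTerm α) :
    t.realize (M := termModel E S) (fun k => (Quotient.mk (fixedSetoid E S) (σ k) : _)) =
      (Quotient.mk (fixedSetoid E S) (t.subst σ) : _) := by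
  refine (Term.realize_quotient_mk' (fixedSetoid E S) t σ).trans (congrArg _ ?_)
  induction t with
  | var n => rfl
  | func f ts ih =>
    rw [Term.subst, ← funext ih]
    rfl

theorem valid_termModel {E : Set (CylEq α)} (S : Set α) {e : CylEq α} (he : e ∈ E) :
    e.Valid (termModel E S) := by
  intro v
  choose σ hσ using fun k => Quotient.exists_rep (v k)
  obtain rfl : (fun k => Quotient.mk (fixedSetoid E S) (σ k)) = v := funext hσ
  rw [realize_termModel, realize_termModel]
  refine Quotient.sound ⟨∅, Set.finite_empty, Set.empty_disjoint _, fun A hA v _ => ?_⟩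
  simpa only [Term.realize_subst] using hA e he _

theorem isLocallyFiniteDim_termModel {E : Set (CylEq α)} (hE : cylAxioms α ⊆ E) {S : Set α}
    (hS : S.Finite) : IsLocallyFiniteDim (termModel E S) := by
  refine ⟨fun e he => valid_termModel S (hE he), fun a => ?_⟩
  obtain ⟨t, rfl⟩ := Quotient.exists_rep a
  -- For `i` outside both `S` and `t`, the set `{i}` is an admissible `Γ`, and it identifies `c i t`
  -- with `t`.
  refine (hS.union (CylTerm.finite_ind t)).subset fun i hi => ?_
  contrapose! hi
  simp only [Set.mem_union, not_or] at hi
  rw [Set.mem_ofPred_eq, not_not]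
  have hs : (CylTerm.cyl i (CylTerm.x 0)).subst (fun _ => t) = CylTerm.cyl i t := by
    simp only [CylTerm.cyl, CylTerm.x, Functions.apply₁, Term.subst]
    exact congrArg _ (funext fun k => by fin_cases k; rfl)
  have hq : opCyl (termModel E S) i (Quotient.mk (fixedSetoid E S) t) =
      Quotient.mk (fixedSetoid E S) (CylTerm.cyl i t) := by
    rw [← hs, ← realize_termModel]
    exact (realize_cyl (A := termModel E S)
      (fun _ => Quotient.mk (fixedSetoid E S) t) i (CylTerm.x 0)).symm
  refine hq.trans (Quotient.sound ⟨{i}, Set.finite_singleton i, by simpa using hi.1, ?_⟩)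
  intro A hA v hv
  have hcyl : IsCylindric A := fun f hf => hA f (hE hf)
  simpa using hcyl.opCyl_realize (hv i rfl) t hi.2

theorem IsInductiveSet.eq_eqTheory {E : Set (CylEq α)} (hE : IsInductiveSet E) :
    E = eqTheory {A | A ∈ Lf α ∧ ∀ f ∈ E, f.Valid A} := by
  refine Set.Subset.antisymm (fun e he A hA => hA.2 e he) fun e he => ?_
  -- Taking `S = e.ind` ensures that the resulting `Γ` avoids the indices of `e`, as the inductive
  -- rule demands.
  have h := he (termModel E e.ind) ⟨isLocallyFiniteDim_termModel hE.axioms_subset e.finite_ind,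
    fun f hf => valid_termModel _ hf⟩ fun k => Quotient.mk _ (CylTerm.x k)
  rw [realize_termModel, realize_termModel] at h
  obtain ⟨Γ, hf, hd, hΓ⟩ := Quotient.exact h
  refine hE.mem_of_fixedEntails hf hd fun A hA v hv => ?_
  simpa [Term.realize_subst] using hΓ A hA v hv

end TermModel

theorem theorem4p10 {α : Type u} [Infinite α] (E : Set (CylEq α)) :
    IsInductiveSet E ↔ ∃ K : Set (CylTypeAlg α), K ⊆ Lf α ∧ E = eqTheory K := by
  refine ⟨fun hE => ⟨_, fun _ hA => hA.1, hE.eq_eqTheory⟩, ?_⟩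
  rintro ⟨K, hK, rfl⟩
  exact isInductiveSet_eqTheory hK
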